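/- **Conventions.** Graphs are finite and simple. A vertex of a rooted forest is its own ancestor; its depth is its number of proper ancestors (roots have depth $0$), and the height of the forest is the maximum depth of a vertex. The *treedepth* of a graph $G$ is the minimum height of a rooted forest on $V(G)$ such that the two ends of every edge of $G$ are in ancestor–descendant relation. A *$t$-model* of $G$ is such a forest that is a tree (has exactly one root) and has height at most $t$. Let $\mathcal T$ be a $t$-model of $G$. The *ancestor vector* of a vertex $v$ of depth $i$ is the vector in $\{0,1\}^i$ whose $j$-th coordinate ($0\le j<i$) is $1$ iff $v$ is adjacent in $G$ to its ancestor at depth $j$. The *type* of $v$ is the isomorphism class of the rooted subtree of $\mathcal T$ at $v$, each vertex being labelled with its ancestor vector. If a vertex $u$ has more than $k$ children of the same type, a *valid pruning* removes all vertices of the subtree rooted at one of these children; the types are then updated with respect to the remaining vertices. A *$k$-reduced graph* of $G$ (with respect to $\mathcal T$) is an induced subgraph of $G$ obtained by iterating valid prunings, always at the largest possible depth, until no valid pruning is possible. Write $G\simeq_k H$ if $G$ and $H$ satisfy the same first-order sentences (in the language of adjacency and equality) of quantifier depth at most $k$. **Theorem.** There is a computable function $f:\mathbb N^2\to\mathbb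 N$ such that for all $k,t\in\mathbb N$ and every graph $G$ of treedepth at most $t$: 1. there is a graph $H$ with at most $f(k,t)$ vertices such that $G\simeq_k H$ and Duplicator has a winning strategy in the $k$-round Ehrenfeucht–Fraïssé game on $(G,H)$; 2. if $G$ is connected, then $G$ has a $t$-model; 3. for every $t$-model $\mathcal T$ of $G$, a $k$-reduced graph of $G$ with respect to $\mathcal T$ exists, and every such $k$-reduced graph $H$ has at most $f(k,t)$ vertices, satisfies $G\simeq_k H$, and Duplicator has a winning strategy in the $k$-round Ehrenfeucht–Fraïssé game on $(G,H)$. In particular, for connected $G$ the kernel can be obtained by iteratively pruning any $t$-model of $G$. -/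

import Mathlib

namespace TreedepthKernel

/-! ### Rooted forests, elimination trees and treedepth -/

/-- A rooted forest on the vertex set `V`, given by its parent function. The roots are the vertices
without a parent; well-foundedness says that from every vertex one reaches a root by following
parents (for finite `V`: the parent function has no cycle). -/
structure RootedForest (V : Type*) where
  parent : V → Option V
  wf : WellFounded fun u v : V => parent v = some u

namespace RootedForest

variable {V : Type*} (T : RootedForest V)

/-- `u` lies on the path between `v` and the root of `v` (so every vertex is its own ancestor). -/
def IsAncestor (u v : V) : Prop :=
  Relation.ReflTransGen (fun a b => T.parent b = some a) u v

/-- The depth of a vertex: its number of proper ancestors, that is, the number of edges on the path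
to its root. Roots have depth `0`. -/
noncomputable def depth (v : V) : ℕ :=
  {u : V | T.IsAncestor u v ∧ u ≠ v}.ncard

/-- The height of a forest: the maximum depth of a vertex (`0` for the forest without vertices). -/
noncomputable def height : ℕ∞ :=
  ⨆ v, (T.depth v : ℕ∞)

/-- The forest is a tree: it has exactly one root. -/
def IsTree : Prop :=
  ∃! r, T.parent r = none

/-- Every edge of `G` joins a vertex to one of its ancestors or descendants. -/
def IsElimination (G : SimpleGraph V) : Prop :=
  ∀ u v, G.Adj u v → T.IsAncestor u v ∨ T.IsAncestor v u

end RootedForest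

/-- The treedepth of `G`: the minimum height of a rooted forest on the vertex set of `G` in which
the ends of every edge of `G` are in ancestor-descendant relation. -/
noncomputable def treedepth {V : Type*} (G : SimpleGraph V) : ℕ∞ :=
  ⨅ (T : RootedForest V) (_ : T.IsElimination G), T.height

/-- `T` is a `t`-model of `G`: an elimination tree of `G` of depth at most `t`. -/
def IsModel {V : Type*} (G : SimpleGraph V) (T : RootedForest V) (t : ℕ) : Prop :=
  T.IsTree ∧ T.IsElimination G ∧ T.height ≤ t

/-! ### Types and pruning -/

section Pruning

variable {V : Type*} (G : SimpleGraph V) (T : RootedForest V)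

open Classical in
/-- The ancestor vector of a vertex `v` of depth `i`: the 0/1-vector of length `i` whose `j`-th
coordinate says whether `v` is adjacent in `G` to its ancestor at depth `j`, for `j < i`. -/
noncomputable def ancestorVector (v : V) : List Bool :=
  List.ofFn fun j : Fin (T.depth v) =>
    decide (∃ a, T.IsAncestor a v ∧ T.depth a = j ∧ G.Adj v a)

/-- The vertices of the subtree rooted at `v`, when only the vertices in `S` are left. -/
def subtree (S : Set V) (v : V) : Set V :=
  {x | x ∈ S ∧ T.IsAncestor v x}

/-- `u` and `v` have the same type in the graph with remaining vertex set `S`: the subtrees rooted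
at `u` and at `v`, with each vertex labelled by its ancestor vector, are isomorphic as labelled
rooted trees. -/
def SameType (S : Set V) (u v : V) : Prop :=
  ∃ e : subtree T S u ≃ subtree T S v,
    (∀ x : subtree T S u, (x : V) = u ↔ (e x : V) = v) ∧
    (∀ x y : subtree T S u,
      T.parent (y : V) = some (x : V) ↔ T.parent (e y : V) = some (e x : V)) ∧
    ∀ x : subtree T S u, ancestorVector G T (x : V) = ancestorVector G T (e x : V)

/-- In the graph with remaining vertex set `S`, the subtree rooted at `w` may be pruned: `w` has
a parent `u`, and more than `k` of the remaining children of `u` (among which `w` itself) have the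
type of `w`. -/
def CanPrune (k : ℕ) (S : Set V) (w : V) : Prop :=
  w ∈ S ∧ ∃ u, T.parent w = some u ∧
    k < {w' : V | w' ∈ S ∧ T.parent w' = some u ∧ SameType G T S w w'}.ncard

/-- One valid pruning operation, from the remaining vertex set `S` to `S'`, performed at the largest
possible depth. -/
def PruneStep (k : ℕ) (S S' : Set V) : Prop :=
  ∃ w, CanPrune G T k S w ∧ (∀ w', CanPrune G T k S w' → T.depth w' ≤ T.depth w) ∧
    S' = S \ subtree T S w

/-- `S` is the vertex set of a `k`-reduced graph of `G` (with respect to `T`): it is obtained from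
the full vertex set by iterating valid pruning operations until none is possible. The `k`-reduced
graph itself is `G.induce S`. -/
def IsReduced (k : ℕ) (S : Set V) : Prop :=
  Relation.ReflTransGen (PruneStep G T k) Set.univ S ∧ ∀ w, ¬ CanPrune G T k S w

end Pruning

/-! ### First-order logic on graphs and the Ehrenfeucht-Fraïssé game -/

open FirstOrder

/-- The quantifier depth of a first-order formula on graphs. (Negation, `∧`, `∨` and `∃` are
expressed in Mathlib through `⊥`, `⟹` and `∀`, with the usual quantifier depth.) -/
def quantifierDepth {α : Type} : {n : ℕ} → Language.graph.BoundedFormula α n → ℕ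
  | _, .falsum => 0
  | _, .equal _ _ => 0
  | _, .rel _ _ => 0
  | _, .imp φ ψ => max (quantifierDepth φ) (quantifierDepth ψ)
  | _, .all φ => quantifierDepth φ + 1

/-- The graph `G` satisfies the first-order sentence `φ`. -/
def Satisfies {V : Type*} (G : SimpleGraph V) (φ : Language.graph.Sentence) : Prop :=
  letI := G.structure
  V ⊨ φ

/-- `G` and `H` satisfy the same first-order sentences of quantifier depth at most `k`. -/
def FOEquiv {V W : Type*} (k : ℕ) (G : SimpleGraph V) (H : SimpleGraph W) : Prop :=
  ∀ φ : Language.graph.Sentence, quantifierDepth φ ≤ k → (Satisfies G φ ↔ Satisfies H φ)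

/-- The correspondence between the positions played in `G` and in `H` is an isomorphism between the
subgraphs that they induce. -/
def IsPartialIso {V W : Type*} (G : SimpleGraph V) (H : SimpleGraph W) (p : List (V × W)) : Prop :=
  ∀ a ∈ p, ∀ b ∈ p, (a.1 = b.1 ↔ a.2 = b.2) ∧ (G.Adj a.1 b.1 ↔ H.Adj a.2 b.2)

/-- Duplicator wins the Ehrenfeucht-Fraïssé game on `(G, H)` with the given number of rounds left,
when the pairs in the list have been played so far. -/
def DuplicatorWinsFrom {V W : Type*} (G : SimpleGraph V) (H : SimpleGraph W) :
    ℕ → List (V × W) → Prop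
  | 0, p => IsPartialIso G H p
  | m + 1, p => IsPartialIso G H p ∧
      (∀ x : V, ∃ y : W, DuplicatorWinsFrom G H m ((x, y) :: p)) ∧
      (∀ y : W, ∃ x : V, DuplicatorWinsFrom G H m ((x, y) :: p))

/-- Duplicator has a winning strategy in the `k`-round Ehrenfeucht-Fraïssé game on `(G, H)`. -/
def DuplicatorWins {V W : Type*} (k : ℕ) (G : SimpleGraph V) (H : SimpleGraph W) : Prop :=
  DuplicatorWinsFrom G H k []

end TreedepthKernel

/-!
A single valid pruning does not change the outcome of the `k`-round game
(`duplicatorWins_diff_subtree`). The adjacency of a vertex to its ancestors is recorded in its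
label, and there are no other edges, so exchanging the subtrees at two siblings of the same type is
an automorphism (`SameType.exists_swap`). Duplicator plays such that the position is always the
restriction of an automorphism `σ` of the larger graph. If `σ` sends Spoiler's move into the removed
subtree, then one of the at least `k` other copies of this subtree contains none of the fewer than
`k` vertices chosen so far, and composing `σ` with the exchange of the two subtrees repairs `σ`
without affecting the earlier moves (`duplicatorWins_induce_of_automorphisms`). Strategies compose
(`DuplicatorWins.trans`), which covers iterated pruning, and the existence of a strategy implies
agreement on the sentences of quantifier depth at most `k` (`DuplicatorWins.foEquiv`).

When no pruning is possible, the type of a vertex is determined by its label and by the numbers of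
its children of each type, and these numbers are bounded. Induction on the number of levels below a
vertex therefore bounds the number of types (`exists_typeCode`) and then the number of vertices of a
subtree (`ncard_subtree_le`), both by an explicit recursion.

For disconnected graphs there is only an elimination forest. The roots are then treated as siblings
of each other and pruned in the same way, whence the definition of `sameTypeSiblings`.
-/

namespace TreedepthKernel

/-! ### The size bound -/

/-- The pair `(N, s)` for parameters `k`, `t` and subtrees with at most `h` levels: `N` bounds
the number of types of the roots of such subtrees, `s` the number of their vertices, provided that
no vertex has more than `k + 1` children of the same type. -/
def typeSizeBound (k t : ℕ) : ℕ → ℕ × ℕ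
  | 0 => (1, 0)
  | h + 1 => (2 ^ t * (k + 2) ^ (typeSizeBound k t h).1,
      1 + (k + 1) * (typeSizeBound k t h).1 * (typeSizeBound k t h).2)

/-- The bound on the number of vertices of a kernel. The `t + 1` levels of a forest of height `t`
are treated as those below an additional common root, hence the index `t + 2`. -/
def kernelBound (k t : ℕ) : ℕ := (typeSizeBound k t (t + 2)).2

theorem computable₂_kernelBound : Computable₂ kernelBound := by
  have hpow : Primrec₂ fun m n : ℕ => m ^ n := Primrec₂.unpaired'.1 Nat.Primrec.pow
  have hk : Primrec fun x : (ℕ × ℕ) × (ℕ × (ℕ × ℕ)) => x.1.1 := Primrec.fst.comp Primrec.fst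
  have ht : Primrec fun x : (ℕ × ℕ) × (ℕ × (ℕ × ℕ)) => x.1.2 := Primrec.snd.comp Primrec.fst
  have hp : Primrec fun x : (ℕ × ℕ) × (ℕ × (ℕ × ℕ)) => x.2.2 := Primrec.snd.comp Primrec.snd
  have hN := Primrec.fst.comp hp
  have hs := Primrec.snd.comp hp
  have hstep : Primrec₂ fun (x : ℕ × ℕ) (y : ℕ × (ℕ × ℕ)) =>
      (2 ^ x.2 * (x.1 + 2) ^ y.2.1, 1 + (x.1 + 1) * y.2.1 * y.2.2) :=
    Primrec.pair
      (Primrec.nat_mul.comp (hpow.comp (Primrec.const 2) ht)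
        (hpow.comp (Primrec.nat_add.comp hk (Primrec.const 2)) hN))
      (Primrec.nat_add.comp (Primrec.const 1)
        (Primrec.nat_mul.comp
          (Primrec.nat_mul.comp (Primrec.nat_add.comp hk (Primrec.const 1)) hN) hs))
  have hrec := Primrec.nat_rec' (f := fun x : ℕ × ℕ => x.2 + 2)
    (Primrec.nat_add.comp Primrec.snd (Primrec.const 2)) (Primrec.const ((1, 0) : ℕ × ℕ)) hstep
  have h : Primrec fun x : ℕ × ℕ => kernelBound x.1 x.2 :=
    (Primrec.snd.comp hrec).of_eq fun x => by
      have key : ∀ n, (Nat.rec (1, 0) (fun n IH =>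
          (2 ^ x.2 * (x.1 + 2) ^ IH.1, 1 + (x.1 + 1) * IH.1 * IH.2)) n : ℕ × ℕ) =
            typeSizeBound x.1 x.2 n := by
        intro n
        induction n with
        | zero => rfl
        | succ n ih => rw [typeSizeBound, ← ih]
      exact congrArg Prod.snd (key (x.2 + 2))
  exact h.to_comp

/-! ### The Ehrenfeucht-Fraïssé game -/

section Game

open FirstOrder

variable {U V W : Type*} {F : SimpleGraph U} {G : SimpleGraph V} {H : SimpleGraph W}

theorem DuplicatorWinsFrom.isPartialIso {m : ℕ} {p : List (V × W)}
    (h : DuplicatorWinsFrom G H m p) : IsPartialIso G H p := by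
  cases m with
  | zero => exact h
  | succ m => exact h.1

/-- Soundness of the game for formulas: the free variables are interpreted by positions that have
been played. -/
theorem DuplicatorWinsFrom.realize_iff {n : ℕ} (φ : Language.graph.BoundedFormula Empty n) :
    ∀ {m : ℕ} {p : List (V × W)} {v : Fin n → V} {w : Fin n → W},
      DuplicatorWinsFrom G H m p → (∀ i, (v i, w i) ∈ p) → quantifierDepth φ ≤ m →
        ((letI := G.structure; φ.Realize Empty.elim v) ↔
          (letI := H.structure; φ.Realize Empty.elim w)) := by
  induction φ with
  | falsum => intros; exact Iff.rfl
  | equal t₁ t₂ =>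
    intro m p v w h hp _
    match t₁, t₂ with
    | .var (.inr i), .var (.inr j) => exact (h.isPartialIso _ (hp i) _ (hp j)).1
  | rel R ts =>
    intro m p v w h hp _
    cases R
    rcases hi : ts 0 with (a | i) | ⟨f, _⟩
    · exact a.elim
    · rcases hj : ts 1 with (a | j) | ⟨f, _⟩
      · exact a.elim
      · have := (h.isPartialIso _ (hp i) _ (hp j)).2
        simp only [Language.BoundedFormula.Realize, Language.Structure.RelMap, hi, hj]
        exact this
      · exact f.elim
    · exact f.elim
  | imp φ ψ ih₁ ih₂ =>
    intro m p v w h hp hd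
    exact imp_congr (ih₁ h hp ((le_max_left _ _).trans hd)) (ih₂ h hp ((le_max_right _ _).trans hd))
  | all φ ih =>
    intro m p v w h hp hd
    obtain _ | m := m
    · simp [quantifierDepth] at hd
    have hd' : quantifierDepth φ ≤ m := by simpa [quantifierDepth] using hd
    have hsnoc : ∀ x y i, ((Fin.snoc v x : Fin _ → V) i, (Fin.snoc w y : Fin _ → W) i) ∈
        (x, y) :: p := by
      intro x y i
      refine Fin.lastCases ?_ (fun i => ?_) i
      · simp
      · simpa using Or.inr (hp i)
    constructor
    · intro hG y
      obtain ⟨x, hx⟩ := h.2.2 y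
      exact (ih hx (hsnoc x y) hd').1 (hG x)
    · intro hH x
      obtain ⟨y, hy⟩ := h.2.1 x
      exact (ih hy (hsnoc x y) hd').2 (hH y)

theorem DuplicatorWins.foEquiv {k : ℕ} (h : DuplicatorWins k G H) : FOEquiv k G H := by
  intro φ hφ
  have := DuplicatorWinsFrom.realize_iff φ (v := default) (w := default) h (fun i => i.elim0) hφ
  unfold Satisfies Language.Sentence.Realize Language.Formula.Realize
  rwa [Subsingleton.elim (default : Empty → V) Empty.elim,
    Subsingleton.elim (default : Empty → W) Empty.elim]

/-- Strategies compose: a record `r` of triples stands for a play on `(F, G)` and a play on `(G, H)`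
with the same moves in `G`. -/
theorem DuplicatorWinsFrom.trans : ∀ {m : ℕ} {r : List (U × V × W)},
    DuplicatorWinsFrom F G m (r.map fun x => (x.1, x.2.1)) →
    DuplicatorWinsFrom G H m (r.map fun x => (x.2.1, x.2.2)) →
    DuplicatorWinsFrom F H m (r.map fun x => (x.1, x.2.2)) := by
  have iso : ∀ {r : List (U × V × W)}, IsPartialIso F G (r.map fun x => (x.1, x.2.1)) →
      IsPartialIso G H (r.map fun x => (x.2.1, x.2.2)) →
      IsPartialIso F H (r.map fun x => (x.1, x.2.2)) := by
    intro r h₁ h₂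
    simp only [IsPartialIso, List.forall_mem_map] at h₁ h₂ ⊢
    exact fun a ha b hb => ⟨(h₁ a ha b hb).1.trans (h₂ a ha b hb).1,
      (h₁ a ha b hb).2.trans (h₂ a ha b hb).2⟩
  intro m
  induction m with
  | zero => exact iso
  | succ m ih =>
    intro r h₁ h₂
    refine ⟨iso h₁.1 h₂.1, fun x => ?_, fun z => ?_⟩
    · obtain ⟨y, hy⟩ := h₁.2.1 x
      obtain ⟨z, hz⟩ := h₂.2.1 y
      exact ⟨z, ih (r := (x, y, z) :: r) hy hz⟩
    · obtain ⟨y, hy⟩ := h₂.2.2 z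
      obtain ⟨x, hx⟩ := h₁.2.2 y
      exact ⟨x, ih (r := (x, y, z) :: r) hx hy⟩

theorem DuplicatorWins.trans {k : ℕ} (h₁ : DuplicatorWins k F G) (h₂ : DuplicatorWins k G H) :
    DuplicatorWins k F H :=
  DuplicatorWinsFrom.trans (r := []) h₁ h₂

theorem isPartialIso_of_iso (e : G ≃g H) {p : List (V × W)} (hp : ∀ a ∈ p, e a.1 = a.2) :
    IsPartialIso G H p := by
  intro a ha b hb
  rw [← hp a ha, ← hp b hb]
  exact ⟨e.injective.eq_iff.symm, e.map_adj_iff.symm⟩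

theorem duplicatorWins_of_iso (e : G ≃g H) (k : ℕ) : DuplicatorWins k G H := by
  suffices ∀ (m : ℕ) (p : List (V × W)), (∀ a ∈ p, e a.1 = a.2) → DuplicatorWinsFrom G H m p from
    this k [] (by simp)
  intro m
  induction m with
  | zero => exact fun p hp => isPartialIso_of_iso e hp
  | succ m ih =>
    refine fun p hp => ⟨isPartialIso_of_iso e hp, fun x => ⟨e x, ih _ ?_⟩,
      fun y => ⟨e.symm y, ih _ ?_⟩⟩
    · simpa using hp
    · simpa using hp

/-- Let `S' ⊆ S`. If any fewer than `k` vertices of `S'` are fixed by an automorphism of `G[S]` that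
maps `S \ S'` into `S'`, then Duplicator wins the `k`-round game on `G[S]` and `G[S']`: she keeps
all pairs played so far on the graph of an automorphism of `G[S]`, which she corrects whenever it
would send Spoiler's move outside `S'`. -/
theorem duplicatorWins_induce_of_automorphisms {S S' : Set V} (hS : S' ⊆ S) (k : ℕ)
    (hG : ∀ l : List S', l.length < k → ∃ τ : G.induce S ≃g G.induce S,
      (∀ y ∈ l, τ (Set.inclusion hS y) = Set.inclusion hS y) ∧
        ∀ x : S, (x : V) ∉ S' → (τ x : V) ∈ S') :
    DuplicatorWins k (G.induce S) (G.induce S') := by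
  have iso : ∀ (p : List (S × S')) (σ : G.induce S ≃g G.induce S),
      (∀ a ∈ p, σ a.1 = Set.inclusion hS a.2) → IsPartialIso (G.induce S) (G.induce S') p := by
    intro p σ hp a ha b hb
    have h := isPartialIso_of_iso σ (p := p.map fun a => (a.1, Set.inclusion hS a.2))
      (by simpa only [List.forall_mem_map] using hp) _ (List.mem_map_of_mem ha) _ (List.mem_map_of_mem hb)
    simpa [(Set.inclusion_injective hS).eq_iff] using h
  suffices ∀ (m : ℕ) (p : List (S × S')), p.length + m ≤ k →
      (∃ σ : G.induce S ≃g G.induce S, ∀ a ∈ p, σ a.1 = Set.inclusion hS a.2) →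
      DuplicatorWinsFrom (G.induce S) (G.induce S') m p from
    this k [] (by simp) ⟨SimpleGraph.Iso.refl, by simp⟩
  intro m
  induction m with
  | zero => exact fun p _ ⟨σ, hσ⟩ => iso p σ hσ
  | succ m ih =>
    rintro p hk ⟨σ, hσ⟩
    refine ⟨iso p σ hσ, fun x => ?_, fun y => ?_⟩
    · by_cases hx : (σ x : V) ∈ S'
      · refine ⟨⟨σ x, hx⟩, ih _ (by simp; omega) ⟨σ, ?_⟩⟩
        simpa [Set.inclusion] using hσ
      · obtain ⟨τ, hτ, hτ'⟩ := hG (p.map Prod.snd) (by simp; omega)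
        refine ⟨⟨τ (σ x), hτ' _ hx⟩, ih _ (by simp; omega) ⟨σ.trans τ, ?_⟩⟩
        intro a ha
        rcases List.mem_cons.1 ha with rfl | ha
        · rfl
        · change τ (σ a.1) = _
          rw [hσ a ha]
          exact hτ _ (List.mem_map_of_mem ha)
    · refine ⟨σ.symm (Set.inclusion hS y), ih _ (by simp; omega) ⟨σ, ?_⟩⟩
      intro a ha
      rcases List.mem_cons.1 ha with rfl | ha
      · exact σ.apply_symm_apply _
      · exact hσ a ha

end Game
/-! ### Ancestors and depth in a rooted forest -/

namespace RootedForest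

variable {V : Type*} (T : RootedForest V) {u v w : V}

theorem isAncestor_refl (v : V) : T.IsAncestor v v := .refl

theorem IsAncestor.trans {T : RootedForest V} (h₁ : T.IsAncestor u v) (h₂ : T.IsAncestor v w) :
    T.IsAncestor u w :=
  Relation.ReflTransGen.trans h₁ h₂

theorem isAncestor_of_parent (h : T.parent v = some u) : T.IsAncestor u v := .single h

theorem isAncestor_iff_of_parent (h : T.parent v = some u) :
    T.IsAncestor w v ↔ w = v ∨ T.IsAncestor w u := by
  constructor
  · intro hw
    rcases Relation.ReflTransGen.cases_tail hw with rfl | ⟨x, hx, hxv⟩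
    · exact .inl rfl
    · obtain rfl : u = x := Option.some.inj (h.symm.trans hxv)
      exact .inr hx
  · rintro (rfl | hw)
    · exact T.isAncestor_refl _
    · exact hw.trans (T.isAncestor_of_parent h)

theorem isAncestor_iff_of_root (h : T.parent v = none) : T.IsAncestor w v ↔ w = v := by
  constructor
  · intro hw
    rcases Relation.ReflTransGen.cases_tail hw with rfl | ⟨x, hx, hxv⟩
    · rfl
    · simp [h] at hxv
  · rintro rfl
    exact T.isAncestor_refl _

theorem not_isAncestor_parent (h : T.parent v = some u) : ¬ T.IsAncestor v u := by
  intro hvu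
  have hcycle : Relation.TransGen (fun a b => T.parent b = some a) v v :=
    Relation.TransGen.tail' hvu h
  exact T.wf.transGen.irrefl.irrefl v hcycle

theorem depth_of_root (h : T.parent v = none) : T.depth v = 0 := by
  simp [depth, T.isAncestor_iff_of_root h]

theorem exists_root (v : V) : ∃ r, T.parent r = none ∧ T.IsAncestor r v := by
  induction v using T.wf.induction with
  | _ v ih =>
    rcases h : T.parent v with _ | u
    · exact ⟨v, h, T.isAncestor_refl v⟩
    · obtain ⟨r, hr, hru⟩ := ih u h
      exact ⟨r, hr, hru.trans (T.isAncestor_of_parent h)⟩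

theorem IsAncestor.total {T : RootedForest V} (hu : T.IsAncestor u w) (hv : T.IsAncestor v w) :
    T.IsAncestor u v ∨ T.IsAncestor v u := by
  have hU : Relator.RightUnique (Function.swap fun a b : V => T.parent b = some a) :=
    fun a b c hb hc => Option.some.inj (hb.symm.trans hc)
  have := Relation.ReflTransGen.total_of_right_unique hU (Relation.reflTransGen_swap.2 hu)
    (Relation.reflTransGen_swap.2 hv)
  exact this.elim (fun h => .inr (Relation.reflTransGen_swap.1 h))
    fun h => .inl (Relation.reflTransGen_swap.1 h)

theorem exists_child_of_isAncestor (h : T.IsAncestor u v) :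
    v = u ∨ ∃ c, T.parent c = some u ∧ T.IsAncestor c v := by
  rcases Relation.ReflTransGen.cases_head h with rfl | h
  · exact .inl rfl
  · exact .inr h

theorem finite_ancestors (v : V) : {u | T.IsAncestor u v}.Finite := by
  induction v using T.wf.induction with
  | _ v ih =>
    rcases h : T.parent v with _ | u
    · simp [T.isAncestor_iff_of_root h]
    · have : {w | T.IsAncestor w v} = insert v {w | T.IsAncestor w u} := by
        ext w
        simp [T.isAncestor_iff_of_parent h]
      rw [this]
      exact (ih u h).insert v

theorem depth_of_parent (h : T.parent v = some u) : T.depth v = T.depth u + 1 := by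
  have hset : {w | T.IsAncestor w v ∧ w ≠ v} = insert u {w | T.IsAncestor w u ∧ w ≠ u} := by
    ext w
    simp only [Set.mem_ofPred_eq, Set.mem_insert_iff, T.isAncestor_iff_of_parent h]
    constructor
    · rintro ⟨rfl | hw, hne⟩
      · exact absurd rfl hne
      · by_cases hwu : w = u
        · exact .inl hwu
        · exact .inr ⟨hw, hwu⟩
    · rintro (rfl | ⟨hw, -⟩)
      · exact ⟨.inr (T.isAncestor_refl _), fun e => T.not_isAncestor_parent h
          (e ▸ T.isAncestor_refl _)⟩
      · exact ⟨.inr hw, fun e => T.not_isAncestor_parent h (e ▸ hw)⟩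
  rw [depth, hset, Set.ncard_insert_of_notMem (by simp)
    ((T.finite_ancestors u).subset fun w hw => hw.1), depth]

theorem IsAncestor.eq_or_depth_lt {T : RootedForest V} (h : T.IsAncestor u v) :
    u = v ∨ T.depth u < T.depth v := by
  induction h with
  | refl => exact .inl rfl
  | tail _ hbc ih =>
    have := T.depth_of_parent hbc
    rcases ih with rfl | ih <;> right <;> omega

theorem IsAncestor.eq_of_depth_le {T : RootedForest V} (h : T.IsAncestor u v)
    (hd : T.depth v ≤ T.depth u) : u = v :=
  h.eq_or_depth_lt.resolve_right hd.not_gt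

theorem IsAncestor.eq_of_depth_eq {T : RootedForest V} (hu : T.IsAncestor u w)
    (hv : T.IsAncestor v w) (hd : T.depth u = T.depth v) : u = v :=
  (hu.total hv).elim (fun h => h.eq_of_depth_le hd.ge) fun h => (h.eq_of_depth_le hd.le).symm

theorem depth_eq_of_parent_eq (h : T.parent u = T.parent v) : T.depth u = T.depth v := by
  rcases hv : T.parent v with _ | x
  · rw [T.depth_of_root hv, T.depth_of_root (h.trans hv)]
  · rw [T.depth_of_parent hv, T.depth_of_parent (h.trans hv)]

/-- Along an edge of `G` the root cannot change. -/
theorem isTree_of_connected {G : SimpleGraph V} (hT : T.IsElimination G) (hG : G.Connected) :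
    T.IsTree := by
  obtain ⟨v⟩ := hG.nonempty
  obtain ⟨r, hr, hrv⟩ := T.exists_root v
  have hall : ∀ w, T.IsAncestor r w := by
    intro w
    obtain ⟨p⟩ := hG.preconnected v w
    induction p with
    | nil => exact hrv
    | @cons a b c hab p ih =>
      refine ih ?_
      rcases hT _ _ hab with h | h
      · exact hrv.trans h
      · rcases hrv.total h with h | h
        · exact h
        · rw [(T.isAncestor_iff_of_root hr).1 h]
          exact T.isAncestor_refl r
  exact ⟨r, hr, fun s hs => ((T.isAncestor_iff_of_root hs).1 (hall s)).symm⟩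

end RootedForest

theorem exists_isElimination_of_treedepth_le {V : Type*} {G : SimpleGraph V} {t : ℕ}
    (h : treedepth G ≤ t) :
    ∃ T : RootedForest V, T.IsElimination G ∧ T.height ≤ t := by
  by_contra! hc
  have : (t : ℕ∞) + 1 ≤ treedepth G :=
    le_iInf₂ fun T hT => Order.add_one_le_of_lt (hc T hT)
  exact absurd ((Order.add_one_le_iff_of_not_isMax (by simp)).1 (this.trans h)) (lt_irrefl _)

/-! ### Remaining vertex sets -/

section Subtree

variable {V : Type*} {T : RootedForest V} {S : Set V} {u v w x y : V}

variable (T) in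
/-- The set `S` contains the parents of its elements, so that it spans a forest with the same
ancestors and depths. -/
def ParentClosed (S : Set V) : Prop :=
  ∀ v ∈ S, ∀ u, T.parent v = some u → u ∈ S

theorem ParentClosed.of_isAncestor (hS : ParentClosed T S) (h : T.IsAncestor u v) (hv : v ∈ S) :
    u ∈ S := by
  induction h with
  | refl => exact hv
  | tail _ hbc ih => exact ih (hS _ hv _ hbc)

theorem ParentClosed.diff_subtree (hS : ParentClosed T S) (w : V) :
    ParentClosed T (S \ subtree T S w) :=
  fun v hv u hu => ⟨hS v hv.1 u hu, fun h => hv.2 ⟨hv.1, h.2.trans (T.isAncestor_of_parent hu)⟩⟩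

theorem self_mem_subtree (hv : v ∈ S) : v ∈ subtree T S v := ⟨hv, T.isAncestor_refl v⟩

theorem subtree_eq_insert (hv : v ∈ S) (hS : ParentClosed T S) :
    subtree T S v = insert v (⋃ c : {c // c ∈ S ∧ T.parent c = some v}, subtree T S c) := by
  ext x
  simp only [Set.mem_insert_iff, Set.mem_iUnion]
  constructor
  · rintro ⟨hx, hvx⟩
    rcases T.exists_child_of_isAncestor hvx with rfl | ⟨c, hc, hcx⟩
    · exact .inl rfl
    · exact .inr ⟨⟨c, hS.of_isAncestor hcx hx, hc⟩, hx, hcx⟩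
  · rintro (rfl | ⟨⟨c, _, hc⟩, hx, hcx⟩)
    · exact self_mem_subtree hv
    · exact ⟨hx, (T.isAncestor_of_parent hc).trans hcx⟩

theorem subtree_disjoint (hd : T.depth u = T.depth v) (hne : u ≠ v) (hx : x ∈ subtree T S u) :
    x ∉ subtree T S v :=
  fun hx' => hne (hx.2.eq_of_depth_eq hx'.2 hd)

end Subtree
/-! ### Types -/

section Types

variable {V : Type*} {G : SimpleGraph V} {T : RootedForest V} {S : Set V} {u v w c x y x' y' : V}

@[simp]
theorem length_ancestorVector (G : SimpleGraph V) (T : RootedForest V) (v : V) :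
    (ancestorVector G T v).length = T.depth v := by
  simp [ancestorVector]

theorem depth_eq_of_ancestorVector_eq (h : ancestorVector G T x = ancestorVector G T y) :
    T.depth x = T.depth y := by
  simpa using congrArg List.length h

theorem adj_iff_ancestorVector (hxy : T.IsAncestor x y) :
    G.Adj y x ↔ (ancestorVector G T y)[T.depth x]? = some true := by
  rcases hxy.eq_or_depth_lt with rfl | hlt
  · simp
  · rw [List.getElem?_eq_getElem (by simpa using hlt)]
    simp only [ancestorVector, List.getElem_ofFn, Option.some.injEq, decide_eq_true_eq]
    constructor
    · exact fun h => ⟨x, hxy, rfl, h⟩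
    · rintro ⟨a, ha, hd, h⟩
      rwa [← ha.eq_of_depth_eq hxy hd]

theorem adj_iff_of_ancestorVector_eq (hxy : T.IsAncestor x y) (hxy' : T.IsAncestor x' y')
    (hx : T.depth x = T.depth x') (hy : ancestorVector G T y = ancestorVector G T y') :
    G.Adj y x ↔ G.Adj y' x' := by
  rw [adj_iff_ancestorVector hxy, adj_iff_ancestorVector hxy', hx, hy]

variable (G T S) in
/-- The map `f`, of which only the values on the subtree at `u` matter, is a homomorphism of labelled
rooted trees from this subtree to the subtree at `v`. -/
structure IsTypeMap (u v : V) (f : V → V) : Prop where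
  mapsTo : Set.MapsTo f (subtree T S u) (subtree T S v)
  map_root : f u = v
  map_parent : ∀ ⦃x⦄, x ∈ subtree T S u → ∀ ⦃y⦄, y ∈ subtree T S u →
    T.parent y = some x → T.parent (f y) = some (f x)
  map_label : ∀ ⦃x⦄, x ∈ subtree T S u → ancestorVector G T (f x) = ancestorVector G T x

theorem SameType.exists_isTypeMap (h : SameType G T S u v) (hu : u ∈ S) (hv : v ∈ S) :
    ∃ f g, IsTypeMap G T S u v f ∧ IsTypeMap G T S v u g ∧
      Set.LeftInvOn g f (subtree T S u) ∧ Set.LeftInvOn f g (subtree T S v) := by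
  classical
  obtain ⟨e, hroot, hpar, hlab⟩ := h
  set f : V → V := fun x => if h : x ∈ subtree T S u then e ⟨x, h⟩ else x with hf
  set g : V → V := fun x => if h : x ∈ subtree T S v then e.symm ⟨x, h⟩ else x with hg
  have hf' : ∀ (x : V) (h : x ∈ subtree T S u), f x = e ⟨x, h⟩ := fun x h => dif_pos h
  have hg' : ∀ (x : V) (h : x ∈ subtree T S v), g x = e.symm ⟨x, h⟩ := fun x h => dif_pos h
  have hu' := self_mem_subtree (T := T) hu
  have hv' := self_mem_subtree (T := T) hv
  refine ⟨f, g, ⟨fun x hx => ?_, ?_, fun x hx y hy hxy => ?_, fun x hx => ?_⟩,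
    ⟨fun x hx => ?_, ?_, fun x hx y hy hxy => ?_, fun x hx => ?_⟩, fun x hx => ?_, fun x hx => ?_⟩
  · rw [hf' x hx]; exact (e _).2
  · rw [hf' u hu']; exact (hroot ⟨u, hu'⟩).1 rfl
  · rw [hf' x hx, hf' y hy]; exact (hpar ⟨x, hx⟩ ⟨y, hy⟩).1 hxy
  · rw [hf' x hx]; exact (hlab ⟨x, hx⟩).symm
  · rw [hg' x hx]; exact (e.symm _).2
  · rw [hg' v hv', hroot, e.apply_symm_apply]
  · rw [hg' x hx, hg' y hy, hpar, e.apply_symm_apply, e.apply_symm_apply]; exact hxy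
  · rw [hg' x hx, hlab, e.apply_symm_apply]
  · rw [hf' x hx, hg' _ (e _).2, Subtype.coe_eta, e.symm_apply_apply]
  · rw [hg' x hx, hf' _ (e.symm _).2, Subtype.coe_eta, e.apply_symm_apply]

theorem IsTypeMap.sameType {f : V → V} (hf : IsTypeMap G T S u v f) (hu : u ∈ S)
    (hS : ParentClosed T S) (hbij : Set.BijOn f (subtree T S u) (subtree T S v)) :
    SameType G T S u v := by
  have hval : ∀ x, (hbij.equiv f x : V) = f x := fun x => rfl
  have hu' := self_mem_subtree (T := T) hu
  refine ⟨hbij.equiv f, fun x => ?_, fun x y => ?_, fun x => ?_⟩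
  · rw [hval, ← hf.map_root, hbij.injOn.eq_iff x.2 hu']
  · rw [hval, hval]
    refine ⟨fun h => hf.map_parent x.2 y.2 h, fun h => ?_⟩
    -- `y` is not the root of the subtree since `f x` would lie strictly above `v`
    rcases hp : T.parent (y : V) with _ | z
    · have h₁ := T.depth_of_parent h
      rw [depth_eq_of_ancestorVector_eq (hf.map_label y.2), T.depth_of_root hp] at h₁
      omega
    · rcases (T.isAncestor_iff_of_parent hp).1 y.2.2 with huy | huz
      · rw [← huy, hf.map_root] at h
        exact absurd (hf.mapsTo x.2).2 (T.not_isAncestor_parent h)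
      · have hz : z ∈ subtree T S u := ⟨hS _ y.2.1 _ hp, huz⟩
        have h₂ := (hf.map_parent hz y.2 hp).symm.trans h
        rw [hbij.injOn hz x.2 (Option.some.inj h₂)]
  · rw [hval, hf.map_label x.2]

/-- Labelled trees are isomorphic if their roots have the same label and the subtrees at the children
of the roots can be matched up to isomorphism. -/
theorem SameType.of_children (hS : ParentClosed T S) (hu : u ∈ S) (hv : v ∈ S)
    (hlab : ancestorVector G T u = ancestorVector G T v)
    (ε : {c // c ∈ S ∧ T.parent c = some u} ≃ {c // c ∈ S ∧ T.parent c = some v})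
    (hε : ∀ c : {c // c ∈ S ∧ T.parent c = some u}, SameType G T S c (ε c)) : SameType G T S u v := by
  classical
  choose F F' hF hF' hl hr using fun c => (hε c).exists_isTypeMap c.2.1 (ε c).2.1
  have hbij : ∀ c, Set.BijOn (F c) (subtree T S c) (subtree T S (ε c)) := fun c =>
    Set.InvOn.bijOn ⟨hl c, hr c⟩ (hF c).mapsTo (hF' c).mapsTo
  have huniq : ∀ {x z} (a b : {c // c ∈ S ∧ T.parent c = some z}), x ∈ subtree T S a →
      x ∈ subtree T S b → a = b := by
    intro x z a b ha hb
    refine Subtype.ext (ha.2.eq_of_depth_eq hb.2 ?_)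
    rw [T.depth_of_parent a.2.2, T.depth_of_parent b.2.2]
  have hne : ∀ {z} (a : {c // c ∈ S ∧ T.parent c = some z}), z ∉ subtree T S a :=
    fun a ha => T.not_isAncestor_parent a.2.2 ha.2
  let f : V → V := fun x =>
    if h : ∃ c : {c // c ∈ S ∧ T.parent c = some u}, x ∈ subtree T S c then F h.choose x else v
  have hfc : ∀ (c : {c // c ∈ S ∧ T.parent c = some u}) {x}, x ∈ subtree T S c → f x = F c x := by
    intro c x hx
    have h : ∃ c : {c // c ∈ S ∧ T.parent c = some u}, x ∈ subtree T S c := ⟨c, hx⟩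
    rw [show f x = F h.choose x from dif_pos h, huniq _ _ h.choose_spec hx]
  have hfu : f u = v := dif_neg fun ⟨c, hc⟩ => hne c hc
  have hcases : ∀ {z x}, z ∈ S → x ∈ subtree T S z →
      x = z ∨ ∃ c : {c // c ∈ S ∧ T.parent c = some z}, x ∈ subtree T S c := by
    intro z x hz hx
    rw [subtree_eq_insert hz hS] at hx
    simpa only [Set.mem_insert_iff, Set.mem_iUnion] using hx
  have hlabel : ∀ x ∈ subtree T S u, ancestorVector G T (f x) = ancestorVector G T x := by
    intro x hx
    obtain rfl | ⟨c, hc⟩ := hcases hu hx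
    · rw [hfu, hlab]
    · rw [hfc c hc, (hF c).map_label hc]
  have hmaps : Set.MapsTo f (subtree T S u) (subtree T S v) := by
    intro x hx
    obtain rfl | ⟨c, hc⟩ := hcases hu hx
    · rw [hfu]
      exact self_mem_subtree hv
    · rw [hfc c hc]
      have := (hF c).mapsTo hc
      exact ⟨this.1, (T.isAncestor_of_parent (ε c).2.2).trans this.2⟩
  refine IsTypeMap.sameType (f := f) ⟨hmaps, hfu, fun x hx y hy hxy => ?_, hlabel⟩ hu hS
    ⟨hmaps, fun x hx y hy hxy => ?_, fun y hy => ?_⟩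
  · obtain rfl | ⟨c, hc⟩ := hcases hu hy
    · exact absurd hx.2 (T.not_isAncestor_parent hxy)
    · rcases (T.isAncestor_iff_of_parent hxy).1 hc.2 with hcy | hcx
      · obtain rfl : u = x := by
          have := c.2.2
          rw [hcy, hxy] at this
          exact (Option.some.inj this).symm
        rw [hfc c hc, hfu, ← hcy, (hF c).map_root]
        exact (ε c).2.2
      · have hx' : x ∈ subtree T S c := ⟨hx.1, hcx⟩
        rw [hfc c hc, hfc c hx']
        exact (hF c).map_parent hx' hc hxy
  · have hd : T.depth x = T.depth y := by
      rw [← depth_eq_of_ancestorVector_eq (hlabel x hx), hxy,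
        depth_eq_of_ancestorVector_eq (hlabel y hy)]
    obtain rfl | ⟨c, hc⟩ := hcases hu hx
    · exact hy.2.eq_of_depth_le hd.ge
    · obtain rfl | ⟨c', hc'⟩ := hcases hu hy
      · exact (hx.2.eq_of_depth_le hd.le).symm
      · rw [hfc c hc, hfc c' hc'] at hxy
        obtain rfl : c = c' := ε.injective
          (huniq _ _ ((hF c).mapsTo hc) (hxy ▸ (hF c').mapsTo hc'))
        exact (hbij c).injOn hc hc' hxy
  · obtain rfl | ⟨d, hd⟩ := hcases hv hy
    · exact ⟨u, self_mem_subtree hu, hfu⟩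
    · obtain ⟨c, rfl⟩ := ε.surjective d
      obtain ⟨x, hx, rfl⟩ := (hbij c).surjOn hd
      exact ⟨x, ⟨hx.1, (T.isAncestor_of_parent c.2.2).trans hx.2⟩, hfc c hx⟩

/-- Exchanging the subtrees at two siblings of the same type is an automorphism: it respects the
ancestor relation and the labels, and these determine the adjacency. -/
theorem SameType.exists_swap (h : SameType G T S w c) (hT : T.IsElimination G)
    (hS : ParentClosed T S) (hw : w ∈ S) (hc : c ∈ S) (hwc : T.parent w = T.parent c)
    (hne : w ≠ c) :
    ∃ τ : G.induce S ≃g G.induce S,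
      (∀ x : S, (x : V) ∉ subtree T S w → (x : V) ∉ subtree T S c → τ x = x) ∧
        ∀ x : S, (x : V) ∈ subtree T S w → (τ x : V) ∈ subtree T S c := by
  classical
  obtain ⟨f, g, hf, hg, hgf, hfg⟩ := h.exists_isTypeMap hw hc
  have hd := T.depth_eq_of_parent_eq hwc
  have hdisj : ∀ {x}, x ∈ subtree T S c → x ∉ subtree T S w := subtree_disjoint hd.symm hne.symm
  let σ : V → V := fun x => if x ∈ subtree T S w then f x else if x ∈ subtree T S c then g x else x
  have hσw : ∀ {x}, x ∈ subtree T S w → σ x = f x := fun hx => if_pos hx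
  have hσc : ∀ {x}, x ∈ subtree T S c → σ x = g x := fun hx =>
    (if_neg (hdisj hx)).trans (if_pos hx)
  have hσ : ∀ {x}, x ∉ subtree T S w → x ∉ subtree T S c → σ x = x := fun hx hx' =>
    (if_neg hx).trans (if_neg hx')
  have hinv : ∀ x, σ (σ x) = x := by
    intro x
    by_cases hx : x ∈ subtree T S w
    · rw [hσw hx, hσc (hf.mapsTo hx), hgf hx]
    by_cases hx' : x ∈ subtree T S c
    · rw [hσc hx', hσw (hg.mapsTo hx'), hfg hx']
    · rw [hσ hx hx', hσ hx hx']
  have hlab : ∀ x, ancestorVector G T (σ x) = ancestorVector G T x := by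
    intro x
    by_cases hx : x ∈ subtree T S w
    · rw [hσw hx, hf.map_label hx]
    by_cases hx' : x ∈ subtree T S c
    · rw [hσc hx', hg.map_label hx']
    · rw [hσ hx hx']
  have hmem : ∀ x ∈ S, σ x ∈ S := by
    intro x hxS
    by_cases hx : x ∈ subtree T S w
    · rw [hσw hx]
      exact (hf.mapsTo hx).1
    by_cases hx' : x ∈ subtree T S c
    · rw [hσc hx']
      exact (hg.mapsTo hx').1
    · rwa [hσ hx hx']
  have hpar : ∀ x y, y ∈ S → T.parent y = some x → T.parent (σ y) = some (σ x) := by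
    intro x y hyS hxy
    have hxS := hS y hyS x hxy
    by_cases hx : x ∈ subtree T S w
    · have hy : y ∈ subtree T S w := ⟨hyS, hx.2.trans (T.isAncestor_of_parent hxy)⟩
      rw [hσw hx, hσw hy]
      exact hf.map_parent hx hy hxy
    by_cases hx' : x ∈ subtree T S c
    · have hy : y ∈ subtree T S c := ⟨hyS, hx'.2.trans (T.isAncestor_of_parent hxy)⟩
      rw [hσc hx', hσc hy]
      exact hg.map_parent hx' hy hxy
    rw [hσ hx hx']
    by_cases hy : y ∈ subtree T S w
    · obtain rfl : w = y := ((T.isAncestor_iff_of_parent hxy).1 hy.2).resolve_right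
        fun h => hx ⟨hxS, h⟩
      rw [hσw hy, hf.map_root, ← hwc, hxy]
    by_cases hy' : y ∈ subtree T S c
    · obtain rfl : c = y := ((T.isAncestor_iff_of_parent hxy).1 hy'.2).resolve_right
        fun h => hx' ⟨hxS, h⟩
      rw [hσc hy', hg.map_root, hwc, hxy]
    · rw [hσ hy hy', hxy]
  have hanc : ∀ {x y}, T.IsAncestor x y → y ∈ S → T.IsAncestor (σ x) (σ y) := by
    intro x y hxy
    induction hxy with
    | refl => exact fun _ => T.isAncestor_refl _
    | tail _ hbc ih =>
      exact fun hyS => (ih (hS _ hyS _ hbc)).trans (T.isAncestor_of_parent (hpar _ _ hyS hbc))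
  have hadj' : ∀ {x y}, y ∈ S → T.IsAncestor x y → G.Adj y x → G.Adj (σ y) (σ x) := by
    intro x y hyS hxy h
    exact (adj_iff_of_ancestorVector_eq hxy (hanc hxy hyS)
      (depth_eq_of_ancestorVector_eq (hlab x)).symm (hlab y).symm).1 h
  have hadj : ∀ {x y}, x ∈ S → y ∈ S → G.Adj x y → G.Adj (σ x) (σ y) := by
    intro x y hxS hyS h
    rcases hT _ _ h with h' | h'
    · exact (hadj' hyS h' h.symm).symm
    · exact hadj' hxS h' h
  refine ⟨⟨⟨fun x => ⟨σ x, hmem x x.2⟩, fun x => ⟨σ x, hmem x x.2⟩,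
    fun x => Subtype.ext (hinv x), fun x => Subtype.ext (hinv x)⟩, ?_⟩, ?_, ?_⟩
  · intro x y
    refine ⟨fun h => ?_, fun h => hadj x.2 y.2 h⟩
    have := hadj (hmem x x.2) (hmem y y.2) h
    rwa [hinv, hinv] at this
  · exact fun x hx hx' => Subtype.ext (hσ hx hx')
  · intro x hx
    change σ x ∈ _
    rw [hσw hx]
    exact hf.mapsTo hx

end Types
/-! ### Pruning preserves equivalence -/

section Prune

variable {V : Type*} {G : SimpleGraph V} {T : RootedForest V} {S : Set V} {w : V} {k : ℕ}

theorem sameType_refl (G : SimpleGraph V) (T : RootedForest V) (S : Set V) (v : V) :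
    SameType G T S v v :=
  ⟨Equiv.refl _, fun _ => Iff.rfl, fun _ _ => Iff.rfl, fun _ => rfl⟩

variable (G T S) in
/-- The remaining siblings of `w` (including `w`) that have the type of `w`. Roots count as siblings
of each other, so that forests can be pruned like trees. -/
def sameTypeSiblings (w : V) : Set V :=
  {w' | w' ∈ S ∧ T.parent w' = T.parent w ∧ SameType G T S w w'}

theorem CanPrune.lt_ncard_sameTypeSiblings (h : CanPrune G T k S w) :
    k < (sameTypeSiblings G T S w).ncard := by
  obtain ⟨-, u, hu, hk⟩ := h
  rwa [sameTypeSiblings, hu]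

theorem duplicatorWins_induce_univ (G : SimpleGraph V) (k : ℕ) :
    DuplicatorWins k G (G.induce Set.univ) :=
  duplicatorWins_of_iso (SimpleGraph.induceUnivIso G).symm k

/-- Removing the subtree at one of more than `k` siblings of the same type: fewer than `k` vertices
cannot meet all the other copies, and one that is avoided is exchanged with the removed one. -/
theorem duplicatorWins_diff_subtree (hT : T.IsElimination G) (hS : ParentClosed T S) (hw : w ∈ S)
    (hk : k < (sameTypeSiblings G T S w).ncard) :
    DuplicatorWins k (G.induce S) (G.induce (S \ subtree T S w)) := by
  classical
  refine duplicatorWins_induce_of_automorphisms Set.sdiff_subset k fun l hl => ?_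
  have huniq : ∀ {y a b}, a ∈ sameTypeSiblings G T S w → b ∈ sameTypeSiblings G T S w →
      T.IsAncestor a y → T.IsAncestor b y → a = b := fun ha hb hay hby =>
    hay.eq_of_depth_eq hby (T.depth_eq_of_parent_eq (ha.2.1.trans hb.2.1.symm))
  obtain ⟨c, hc, hcw, hcl⟩ : ∃ c ∈ sameTypeSiblings G T S w, c ≠ w ∧
      ∀ y ∈ l, (y : V) ∉ subtree T S c := by
    by_contra! hall
    have hall' : ∀ c ∈ sameTypeSiblings G T S w, c ≠ w →
        ∃ y ∈ (l.map Subtype.val).toFinset, y ∈ subtree T S c := fun c hc hcw => by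
      obtain ⟨y, hyl, hy⟩ := hall c hc hcw
      exact ⟨y, List.mem_toFinset.2 (List.mem_map_of_mem hyl), hy⟩
    have : Nonempty V := ⟨w⟩
    choose! y hyl hy using hall'
    have hcard : (sameTypeSiblings G T S w \ {w}).ncard ≤
        (((l.map Subtype.val).toFinset : Finset V) : Set V).ncard := by
      refine Set.ncard_le_ncard_of_injOn y (fun c hc => ?_) (fun a ha b hb hab => ?_)
        (Finset.finite_toSet _)
      · exact hyl c hc.1 hc.2
      · have hb' := hy b hb.1 hb.2
        rw [← hab] at hb'
        exact huniq ha.1 hb.1 (hy a ha.1 ha.2).2 hb'.2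
    have hself : w ∈ sameTypeSiblings G T S w := ⟨hw, rfl, sameType_refl G T S w⟩
    rw [Set.ncard_sdiff_singleton_of_mem hself, Set.ncard_coe_finset] at hcard
    have := (l.map Subtype.val).toFinset_card_le
    rw [List.length_map] at this
    omega
  obtain ⟨τ, hfix, hmove⟩ := hc.2.2.exists_swap hT hS hw hc.1 hc.2.1.symm hcw.symm
  refine ⟨τ, fun y hy => ?_, fun x hx => ?_⟩
  · exact hfix _ (fun h => y.2.2 h) (hcl y hy)
  · have hx' : (x : V) ∈ subtree T S w := by
      by_contra h
      exact hx ⟨x.2, h⟩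
    exact ⟨(τ x).2, subtree_disjoint (T.depth_eq_of_parent_eq hc.2.1) hcw (hmove x hx')⟩

theorem duplicatorWins_of_reflTransGen (hT : T.IsElimination G)
    (h : Relation.ReflTransGen (PruneStep G T k) Set.univ S) :
    ParentClosed T S ∧ DuplicatorWins k G (G.induce S) := by
  induction h with
  | refl => exact ⟨fun _ _ _ _ => Set.mem_univ _, duplicatorWins_induce_univ G k⟩
  | tail _ h ih =>
    obtain ⟨w, hw, -, rfl⟩ := h
    exact ⟨ih.1.diff_subtree w, ih.2.trans
      (duplicatorWins_diff_subtree hT ih.1 hw.1 hw.lt_ncard_sameTypeSiblings)⟩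

variable [Finite V]

theorem ncard_diff_subtree_lt (hw : w ∈ S) : (S \ subtree T S w).ncard < S.ncard :=
  Set.ncard_lt_ncard ⟨Set.sdiff_subset, fun h => (h hw).2 (self_mem_subtree hw)⟩

theorem exists_reduced (G : SimpleGraph V) (T : RootedForest V) (k : ℕ) :
    ∃ S, IsReduced G T k S := by
  suffices ∀ (n : ℕ) (S : Set V), S.ncard = n → ∃ S',
      Relation.ReflTransGen (PruneStep G T k) S S' ∧ ∀ w, ¬ CanPrune G T k S' w from
    this _ _ rfl
  intro n
  induction n using Nat.strong_induction_on with
  | _ n ih =>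
    rintro S rfl
    by_cases hp : ∃ w, CanPrune G T k S w
    · obtain ⟨w, hw, hmax⟩ := Set.exists_max_image {w | CanPrune G T k S w} T.depth
        (Set.toFinite _) hp
      obtain ⟨S', hS', hred⟩ := ih _ (ncard_diff_subtree_lt (T := T) hw.1) _ rfl
      exact ⟨S', .head ⟨w, hw, hmax, rfl⟩ hS', hred⟩
    · exact ⟨S, .refl, not_exists.1 hp⟩

/-- Pruning at the roots as well, an equivalent induced subgraph is found in which no vertex has
more than `k` siblings of its type. -/
theorem exists_duplicatorWins_ncard_sameTypeSiblings_le (hT : T.IsElimination G) (k : ℕ) :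
    ∃ S, ParentClosed T S ∧ DuplicatorWins k G (G.induce S) ∧
      ∀ w ∈ S, (sameTypeSiblings G T S w).ncard ≤ k := by
  suffices ∀ (n : ℕ) (S : Set V), S.ncard = n → ParentClosed T S →
      DuplicatorWins k G (G.induce S) → ∃ S, ParentClosed T S ∧
        DuplicatorWins k G (G.induce S) ∧ ∀ w ∈ S, (sameTypeSiblings G T S w).ncard ≤ k from
    this _ _ rfl (fun _ _ _ _ => Set.mem_univ _) (duplicatorWins_induce_univ G k)
  intro n
  induction n using Nat.strong_induction_on with
  | _ n ih =>
    rintro S rfl hS hdup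
    by_cases hp : ∃ w ∈ S, k < (sameTypeSiblings G T S w).ncard
    · obtain ⟨w, hw, hk⟩ := hp
      exact ih _ (ncard_diff_subtree_lt (T := T) hw) _ rfl (hS.diff_subtree w)
        (hdup.trans (duplicatorWins_diff_subtree hT hS hw hk))
    · push Not at hp
      exact ⟨S, hS, hdup, hp⟩

/-- In a tree, the root is its only sibling. -/
theorem ncard_sameTypeSiblings_le_of_not_canPrune (hT : T.IsTree)
    (h : ∀ w, ¬ CanPrune G T k S w) (hw : w ∈ S) :
    (sameTypeSiblings G T S w).ncard ≤ k + 1 := by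
  rcases hp : T.parent w with _ | u
  · have hsub : sameTypeSiblings G T S w ⊆ {w} := fun x hx =>
      hT.unique (hx.2.1.trans hp) hp
    have := Set.ncard_le_ncard hsub
    rw [Set.ncard_singleton] at this
    omega
  · by_contra! hlt
    refine h w ⟨hw, u, hp, ?_⟩
    rw [sameTypeSiblings, hp] at hlt
    omega

end Prune

/-! ### The size of reduced graphs -/

section Size

variable {V : Type*} [Finite V] {G : SimpleGraph V} {T : RootedForest V} {S : Set V}
  {k t : ℕ}

/-- There are at most `(typeSizeBound k t h).1` types of vertices of depth more than `t - h`: the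
label together with the multiplicities of the types among the children determines the type. -/
theorem exists_typeCode (hS : ParentClosed T S) (hd : ∀ v, T.depth v ≤ t)
    (hk : ∀ w ∈ S, (sameTypeSiblings G T S w).ncard ≤ k + 1) (h : ℕ) :
    ∃ code : V → Fin (typeSizeBound k t h).1, ∀ u ∈ S, ∀ v ∈ S, T.depth u = T.depth v →
      t < T.depth u + h → code u = code v → SameType G T S u v := by
  classical
  induction h with
  | zero => exact ⟨fun _ => ⟨0, Nat.one_pos⟩, fun u _ _ _ _ hu => absurd (hd u) (by omega)⟩
  | succ h ih =>
    obtain ⟨code, hcode⟩ := ih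
    let Children (u : V) := {c // c ∈ S ∧ T.parent c = some u}
    let count (u : V) (τ : Fin (typeSizeBound k t h).1) : ℕ :=
      Nat.card {c : Children u // code c = τ}
    have hcount : ∀ u, t < T.depth u + (h + 1) → ∀ τ, count u τ ≤ k + 1 := by
      intro u hu τ
      rcases isEmpty_or_nonempty {c : Children u // code c = τ} with he | ⟨⟨a, rfl⟩⟩
      · simp [count]
      · refine le_trans ?_ (hk a a.2.1)
        refine Nat.card_le_card_of_injective
          (fun c => ⟨c.1.1, c.1.2.1, c.1.2.2.trans a.2.2.symm, ?_⟩) fun c d hcd => ?_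
        · refine hcode _ a.2.1 _ c.1.2.1 ?_ ?_ c.2.symm
          · rw [T.depth_of_parent a.2.2, T.depth_of_parent c.1.2.2]
          · rw [T.depth_of_parent a.2.2]
            omega
        · exact Subtype.ext (Subtype.ext (Subtype.mk.inj hcd))
    let e : ((Fin t → Bool) × (Fin (typeSizeBound k t h).1 → Fin (k + 2))) ≃
        Fin (typeSizeBound k t (h + 1)).1 :=
      Fintype.equivFinOfCardEq (by simp [typeSizeBound])
    -- capping the count makes the code total; at depth at least `t - h` the cap has no effect
    refine ⟨fun u => e (fun j => (ancestorVector G T u).getD j false,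
      fun τ => ⟨min (count u τ) (k + 1), by omega⟩), fun u hu v hv huv ht heq => ?_⟩
    have heq' := Prod.mk.inj (e.injective heq)
    have hlab : ancestorVector G T u = ancestorVector G T v := by
      refine List.ext_getElem (by simpa using huv) fun j h₁ h₂ => ?_
      have hj : j < t := by
        rw [length_ancestorVector] at h₁
        exact h₁.trans_le (hd u)
      have : (ancestorVector G T u).getD j false = (ancestorVector G T v).getD j false :=
        congrFun heq'.1 ⟨j, hj⟩
      rwa [List.getD_eq_getElem _ _ h₁, List.getD_eq_getElem _ _ h₂] at this
    have hfib : ∀ τ, Nonempty ({c : Children u // code c = τ} ≃ {c : Children v // code c = τ}) := by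
      intro τ
      have h₁ := congrArg Fin.val (congrFun heq'.2 τ)
      have h₂ := hcount u ht τ
      have h₃ := hcount v (huv ▸ ht) τ
      have h₄ : count u τ = count v τ := by
        simp only at h₁
        omega
      exact Finite.card_eq.1 h₄
    let E := fun τ => (hfib τ).some
    let ε := Equiv.ofFiberEquiv (f := fun c : Children u => code c)
      (g := fun c : Children v => code c) E
    refine SameType.of_children hS hu hv hlab ε fun c => ?_
    refine hcode _ c.2.1 _ (ε c).2.1 ?_ ?_ (Equiv.ofFiberEquiv_map E c).symm
    · rw [T.depth_of_parent c.2.2, T.depth_of_parent (ε c).2.2, huv]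
    · rw [T.depth_of_parent c.2.2]
      omega

theorem ncard_iUnion_siblings_le (hS : ParentClosed T S) (hd : ∀ v, T.depth v ≤ t)
    (hk : ∀ w ∈ S, (sameTypeSiblings G T S w).ncard ≤ k + 1) {h : ℕ} (o : Option V)
    (ho : ∀ c ∈ S, T.parent c = o → t < T.depth c + h)
    (hsize : ∀ c ∈ S, T.parent c = o → (subtree T S c).ncard ≤ (typeSizeBound k t h).2) :
    (⋃ c : {c // c ∈ S ∧ T.parent c = o}, subtree T S c).ncard ≤
      (k + 1) * (typeSizeBound k t h).1 * (typeSizeBound k t h).2 := by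
  classical
  have := Fintype.ofFinite V
  obtain ⟨code, hcode⟩ := exists_typeCode hS hd hk h
  have hcard : Fintype.card {c // c ∈ S ∧ T.parent c = o} ≤ (k + 1) * (typeSizeBound k t h).1 := by
    rw [← Finset.card_univ]
    refine (Finset.card_le_mul_card_image_of_maps_to
      (f := fun c : {c // c ∈ S ∧ T.parent c = o} => code c) (t := Finset.univ)
      (fun _ _ => Finset.mem_univ _) (k + 1) fun τ _ => ?_).trans_eq (by simp)
    rcases Finset.eq_empty_or_nonempty
      (Finset.univ.filter fun c : {c // c ∈ S ∧ T.parent c = o} => code c = τ) with he | ⟨a, ha⟩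
    · simp [he]
    · rw [← Set.ncard_coe_finset]
      refine le_trans (Set.ncard_le_ncard_of_injOn Subtype.val (fun c hc => ?_)
        Subtype.val_injective.injOn (Set.toFinite _)) (hk a a.2.1)
      simp only [Finset.coe_filter, Finset.mem_univ, true_and, Set.mem_ofPred_eq,
        Finset.mem_filter] at hc ha
      have hp : T.parent c = T.parent a := c.2.2.trans a.2.2.symm
      exact ⟨c.2.1, hp, hcode _ a.2.1 _ c.2.1 (T.depth_eq_of_parent_eq hp).symm
        (ho a a.2.1 a.2.2) (ha.trans hc.symm)⟩
  calc _ ≤ ∑ c : {c // c ∈ S ∧ T.parent c = o}, (subtree T S c).ncard :=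
        Set.ncard_iUnion_le_of_fintype _
    _ ≤ Fintype.card {c // c ∈ S ∧ T.parent c = o} * (typeSizeBound k t h).2 :=
        Finset.sum_le_card_nsmul _ _ _ fun c _ => hsize c c.2.1 c.2.2
    _ ≤ _ := Nat.mul_le_mul_right _ hcard

theorem ncard_subtree_le (hS : ParentClosed T S) (hd : ∀ v, T.depth v ≤ t)
    (hk : ∀ w ∈ S, (sameTypeSiblings G T S w).ncard ≤ k + 1) (h : ℕ) :
    ∀ v ∈ S, t < T.depth v + h → (subtree T S v).ncard ≤ (typeSizeBound k t h).2 := by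
  induction h with
  | zero => exact fun v _ hv => absurd (hd v) (by omega)
  | succ h ih =>
    intro v hv hvt
    have ho : ∀ c ∈ S, T.parent c = some v → t < T.depth c + h := by
      intro c _ hc
      rw [T.depth_of_parent hc]
      omega
    rw [subtree_eq_insert hv hS, typeSizeBound, add_comm 1]
    exact (Set.ncard_insert_le _ _).trans (Nat.add_le_add_right
      (ncard_iUnion_siblings_le hS hd hk _ ho fun c hc hcv => ih c hc (ho c hc hcv)) 1)

theorem ncard_le_kernelBound (hS : ParentClosed T S) (hd : ∀ v, T.depth v ≤ t)
    (hk : ∀ w ∈ S, (sameTypeSiblings G T S w).ncard ≤ k + 1) :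
    S.ncard ≤ kernelBound k t := by
  have hroots : S ⊆ ⋃ r : {r // r ∈ S ∧ T.parent r = none}, subtree T S r := by
    intro v hv
    obtain ⟨r, hr, hrv⟩ := T.exists_root v
    exact Set.mem_iUnion.2 ⟨⟨r, hS.of_isAncestor hrv hv, hr⟩, hv, hrv⟩
  have ho : ∀ c ∈ S, T.parent c = none → t < T.depth c + (t + 1) := fun c _ _ => by omega
  refine (Set.ncard_le_ncard hroots).trans ((ncard_iUnion_siblings_le hS hd hk none ho
    fun c hc hcr => ncard_subtree_le hS hd hk _ c hc (ho c hc hcr)).trans ?_)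
  exact Nat.le_add_left _ _

end Size

theorem RootedForest.depth_le_of_height_le {V : Type*} {T : RootedForest V} {t : ℕ}
    (h : T.height ≤ t) (v : V) : T.depth v ≤ t :=
  Nat.cast_le.1 ((le_iSup (fun v => (T.depth v : ℕ∞)) v).trans h)

end TreedepthKernel

theorem theorem1p5 :
    ∃ f : ℕ → ℕ → ℕ, Computable₂ f ∧
      ∀ (k t : ℕ) (V : Type*) [Finite V] (G : SimpleGraph V),
        TreedepthKernel.treedepth G ≤ (t : ℕ∞) →
          -- every such graph has a kernel
          (∃ (n : ℕ) (H : SimpleGraph (Fin n)), n ≤ f k t ∧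
            TreedepthKernel.FOEquiv k G H ∧ TreedepthKernel.DuplicatorWins k G H) ∧
          -- if the graph is connected, it has a model to which pruning can be applied
          (G.Connected → ∃ T : TreedepthKernel.RootedForest V, TreedepthKernel.IsModel G T t) ∧
          -- the graphs obtained by exhaustive pruning from any model exist and are kernels
          ∀ T : TreedepthKernel.RootedForest V, TreedepthKernel.IsModel G T t →
            (∃ S : Set V, TreedepthKernel.IsReduced G T k S) ∧
            ∀ S : Set V, TreedepthKernel.IsReduced G T k S →
              S.ncard ≤ f k t ∧
              TreedepthKernel.FOEquiv k G (G.induce S) ∧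
              TreedepthKernel.DuplicatorWins k G (G.induce S) := by
  open TreedepthKernel in
  refine ⟨kernelBound, computable₂_kernelBound, fun k t V _ G hG => ?_⟩
  obtain ⟨T, hT, hheight⟩ := exists_isElimination_of_treedepth_le hG
  refine ⟨?_, fun hconn => ⟨T, T.isTree_of_connected hT hconn, hT, hheight⟩,
    fun T ⟨htree, hT, hheight⟩ => ⟨exists_reduced G T k, fun S hS => ?_⟩⟩
  · obtain ⟨S, hS, hdup, hk⟩ := exists_duplicatorWins_ncard_sameTypeSiblings_le hT k
    let e : S ≃ Fin S.ncard := Finite.equivFinOfCardEq rfl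
    have hwin := hdup.trans (duplicatorWins_of_iso (SimpleGraph.Iso.map e (G.induce S)) k)
    exact ⟨S.ncard, _, ncard_le_kernelBound hS (RootedForest.depth_le_of_height_le hheight)
      fun w hw => (hk w hw).trans (Nat.le_succ k), hwin.foEquiv, hwin⟩
  · obtain ⟨hclosed, hwin⟩ := duplicatorWins_of_reflTransGen hT hS.1
    exact ⟨ncard_le_kernelBound hclosed (RootedForest.depth_le_of_height_le hheight)
      fun w hw => ncard_sameTypeSiblings_le_of_not_canPrune htree hS.2 hw, hwin.foEquiv, hwin⟩
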